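/- Let $f(x)=\min_{a\in A}(c_a+\langle a,x\rangle)$, with $A\subset\mathbb{Z}^2$ finite and $c_a\in\mathbb{R}$, be a tropical (Laurent) polynomial in two variables. Its tropical plane curve $C\subset\mathbb{R}^2$ is the set of points at which the minimum is attained at least twice, with its natural structure of a one-dimensional polyhedral complex. It is dual to the regular subdivision of the Newton polygon $P=\mathrm{conv}(A)$ induced by the coefficients $c_a$. The curve $C$ is called smooth if $P$ is two-dimensional and this subdivision is a unimodular triangulation (all its triangles are lattice triangles of area $\tfrac12$). A skeleton of $C$ is a subgraph (subcomplex) of $C$ that is minimal among the subgraphs of $C$ that are deformation retracts of $C$. A multigraph $G$ is said to be the skeleton of $C$ if its topological realization is homeomorphic to the skeleton of $C$ (edge lengths are ignored). Let $G$ be a finite connected trivalent planar multigraph, where loops and multiple edges are allowed and a loop counts twice in the degree. An embedding of $G$ in the plane is called crowded if there are two different bounded faces that share at least two edges, or there is a bounded face that shares an edge with itself (that is, the face lies on both sides of the edge). The graph $G$ is called crowded if all its embeddings in the plane are crowded. **Lemma.** Crowded graphs are never the skeletons of smooth tropical plane curves: if $G$ is a crowded graph and $C$ is a smooth tropical plane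 curve, then $G$ is not the skeleton of $C$. -/

import Mathlib

open Set Topology unitInterval

/-! ### Multigraphs and their plane embeddings -/

/-- The degree of a vertex of a multigraph; a loop counts twice. -/
noncomputable def Graph.vertexDegree {α β : Type*} (G : Graph α β) (v : α) : ℕ∞ :=
  (G.incidenceSet v).encard + (G.loopSet v).encard

/-- A finite multigraph (loops and parallel edges allowed), with at least one vertex, which is
connected and all of whose vertices have degree three. -/
structure Graph.IsConnectedTrivalent {α β : Type*} (G : Graph α β) : Prop where
  finite_vertexSet : G.vertexSet.Finite
  finite_edgeSet : G.edgeSet.Finite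
  nonempty : G.vertexSet.Nonempty
  connected : ∀ u ∈ G.vertexSet, ∀ v ∈ G.vertexSet, Relation.ReflTransGen G.Adj u v
  trivalent : ∀ v ∈ G.vertexSet, G.vertexDegree v = 3

/-- An embedding of a multigraph in the plane: vertices go to distinct points, every edge goes to
an arc between the images of its ends (a closed curve through the image of its vertex, if the edge
is a loop) without further self-intersections, and the interior of such an arc meets neither the
vertices nor the interior of another arc. For a finite graph this is the same thing as an injective
continuous map from its topological realization to the plane.
The values of `pt` and `arc` outside of the graph play no role. -/
structure PlaneEmbedding {α β : Type*} (G : Graph α β) where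
  pt : α → ℝ × ℝ
  arc : β → C(I, ℝ × ℝ)
  pt_injOn : InjOn pt G.vertexSet
  arc_ends : ∀ e ∈ G.edgeSet, ∃ u v, G.IsLink e u v ∧ arc e 0 = pt u ∧ arc e 1 = pt v
  arc_injOn : ∀ e ∈ G.edgeSet, InjOn (arc e) (Ioo 0 1)
  arc_ne_pt : ∀ e ∈ G.edgeSet, ∀ t ∈ Ioo (0 : I) 1, ∀ v ∈ G.vertexSet, arc e t ≠ pt v
  arc_ne_arc : ∀ e ∈ G.edgeSet, ∀ e' ∈ G.edgeSet, e ≠ e' →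
    ∀ s ∈ Ioo (0 : I) 1, ∀ t ∈ Ioo (0 : I) 1, arc e s ≠ arc e' t

namespace PlaneEmbedding

variable {α β : Type*} {G : Graph α β}

/-- The subset of the plane covered by the embedded graph. -/
def image (D : PlaneEmbedding G) : Set (ℝ × ℝ) :=
  D.pt '' G.vertexSet ∪ ⋃ e ∈ G.edgeSet, range (D.arc e)

/-- A bounded face: a bounded connected component of the complement of the embedded graph. -/
def IsBoundedFace (D : PlaneEmbedding G) (F : Set (ℝ × ℝ)) : Prop :=
  (∃ x ∈ D.imageᶜ, F = connectedComponentIn D.imageᶜ x) ∧ Bornology.IsBounded F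

/-- The edge `e` lies on the boundary of the face `F`. -/
def Borders (D : PlaneEmbedding G) (e : β) (F : Set (ℝ × ℝ)) : Prop :=
  e ∈ G.edgeSet ∧ range (D.arc e) ⊆ frontier F

/-- The face `F` lies on both sides of the edge `e`: near every interior point of the edge, all
points that are not on the edge belong to `F`. -/
def OnBothSides (D : PlaneEmbedding G) (e : β) (F : Set (ℝ × ℝ)) : Prop :=
  e ∈ G.edgeSet ∧ ∀ t ∈ Ioo (0 : I) 1, F ∪ range (D.arc e) ∈ 𝓝 (D.arc e t)

/-- Two different bounded faces share at least two edges, or a bounded face shares an edge with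
itself. -/
def IsCrowded (D : PlaneEmbedding G) : Prop :=
  (∃ F F', D.IsBoundedFace F ∧ D.IsBoundedFace F' ∧ F ≠ F' ∧
    ∃ e e', e ≠ e' ∧ D.Borders e F ∧ D.Borders e F' ∧ D.Borders e' F ∧ D.Borders e' F') ∨
  (∃ F, D.IsBoundedFace F ∧ ∃ e, D.OnBothSides e F)

end PlaneEmbedding

/-- A connected trivalent planar graph all of whose plane embeddings are crowded. -/
def Graph.IsCrowded {α β : Type*} (G : Graph α β) : Prop :=
  G.IsConnectedTrivalent ∧ Nonempty (PlaneEmbedding G) ∧ ∀ D : PlaneEmbedding G, D.IsCrowded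

/-! ### Deformation retracts -/

/-- `S ⊆ C` is a (strong) deformation retract of the subspace `C` of `X`: the identity of `C` is
homotopic, relative to `S`, to a map of `C` into `S`. -/
def IsDeformationRetractOf {X : Type*} [TopologicalSpace X] (S C : Set X) : Prop :=
  S ⊆ C ∧ ∃ r : C(C, C), (∀ x, (r x : X) ∈ S) ∧
    (ContinuousMap.id C).HomotopicRel r (Subtype.val ⁻¹' S)

/-! ### Tropical plane curves -/

/-- A tropical (Laurent) polynomial in two variables over the min-plus algebra: the piecewise linear
function `x ↦ min_{a ∈ support} (coeff a + a.1 * x.1 + a.2 * x.2)`. The values of `coeff` outside of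
the support play no role. -/
structure TropicalPolynomial where
  support : Finset (ℤ × ℤ)
  coeff : ℤ × ℤ → ℝ

/-- A lattice point as a point of the real plane. -/
def latticePoint (a : ℤ × ℤ) : ℝ × ℝ := ((a.1 : ℝ), (a.2 : ℝ))

namespace TropicalPolynomial

/-- The value at `x` of the term of the tropical polynomial with exponent `a`. -/
noncomputable def term (f : TropicalPolynomial) (a : ℤ × ℤ) (x : ℝ × ℝ) : ℝ :=
  f.coeff a + a.1 * x.1 + a.2 * x.2

/-- The exponents of the terms that attain the minimum at `x`. -/
def minimizers (f : TropicalPolynomial) (x : ℝ × ℝ) : Set (ℤ × ℤ) :=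
  {a | a ∈ f.support ∧ ∀ b ∈ f.support, f.term a x ≤ f.term b x}

/-- The tropical plane curve of `f`: the points at which the minimum is attained at least twice. -/
def curve (f : TropicalPolynomial) : Set (ℝ × ℝ) :=
  {x | ∃ a ∈ f.minimizers x, ∃ b ∈ f.minimizers x, a ≠ b}

/-- The Newton polygon, the convex hull of the exponents. -/
def newtonPolygon (f : TropicalPolynomial) : Set (ℝ × ℝ) :=
  convexHull ℝ (latticePoint '' f.support)

/-- The cell, dual to the point `x`, of the regular subdivision of the Newton polygon that is
induced by the coefficients of `f`. Every cell of the subdivision arises in this way. -/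
def dualCell (f : TropicalPolynomial) (x : ℝ × ℝ) : Set (ℝ × ℝ) :=
  convexHull ℝ (latticePoint '' f.minimizers x)

/-- The tropical curve of `f` is smooth: the Newton polygon is two-dimensional, and its dual
subdivision is a unimodular triangulation, i.e. each two-dimensional cell is a triangle with
vertices in the lattice and of area one half. -/
def IsSmooth (f : TropicalPolynomial) : Prop :=
  (interior f.newtonPolygon).Nonempty ∧
  ∀ x, (interior (f.dualCell x)).Nonempty → ∃ u v w : ℤ × ℤ,
    f.dualCell x = convexHull ℝ {latticePoint u, latticePoint v, latticePoint w} ∧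
    |(v.1 - u.1) * (w.2 - u.2) - (v.2 - u.2) * (w.1 - u.1)| = 1

/-- `S` is a subgraph (a subcomplex) of the tropical curve: with each of its points, it contains
the closed cell (vertex, edge or ray) of the curve which has this point in its relative interior.
For `x` on the curve this cell is the set of all `y` at which all terms that are minimal at `x` are
minimal. -/
def IsSubgraph (f : TropicalPolynomial) (S : Set (ℝ × ℝ)) : Prop :=
  S ⊆ f.curve ∧ ∀ x ∈ S, ∀ y, f.minimizers x ⊆ f.minimizers y → y ∈ S

/-- `S` is a skeleton of the tropical curve: it is minimal among the subgraphs that are deformation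
retracts of the curve. -/
def IsSkeleton (f : TropicalPolynomial) (S : Set (ℝ × ℝ)) : Prop :=
  Minimal (fun T => f.IsSubgraph T ∧ IsDeformationRetractOf T f.curve) S

/-- The multigraph `G` is (combinatorially, i.e. forgetting edge lengths and suppressing the
two-valent vertices of the polyhedral complex) the skeleton of the tropical curve: the skeleton is
homeomorphic to the topological realization of `G`. As the skeleton lies in the plane, this says
that it is covered exactly by an embedding of `G` in the plane. -/
def HasSkeletonGraph {α β : Type*} (f : TropicalPolynomial) (G : Graph α β) : Prop :=
  ∃ S, f.IsSkeleton S ∧ ∃ D : PlaneEmbedding G, D.image = S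

end TropicalPolynomial

/-! The complement of a tropical curve is a union of open convex sets, the `region a` on which a
single term is minimal. A deformation retract of the curve contains the frontier of each bounded
region: if it missed a frontier point, the frontier could be deformed so that its winding number
about a point of the region becomes zero, which is impossible
(`IsDeformationRetractOf.frontier_subset`). Winding numbers enter only as the obstruction to a
continuous logarithm. Hence every bounded face of the skeleton is a single region
(`exists_eq_region`).

Convexity now excludes both kinds of crowding. An open convex set is the interior of its closure, so
it cannot lie on both sides of an edge (`not_onBothSides`). Edges shared by two faces lie on the
line where the two terms agree. Two such edges would put a vertex of the graph strictly between two
points at which both terms are minimal (`exists_vertex_between`). Near that vertex the curve stays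
on the line (`eventually_term_eq_of_mem_curve`), which has no room for three half-edges
(`not_three_arcs`). -/

/-! ### Continuous logarithms and frontiers of convex regions -/

/-- A complex-valued function has a continuous logarithm. -/
def HasContinuousLog {A : Type*} [TopologicalSpace A] (f : A → ℂ) : Prop :=
  ∃ L : A → ℂ, Continuous L ∧ ∀ a, Complex.exp (L a) = f a

/-- Homotopy lifting for the covering of the punctured plane by `exp`. -/
theorem HasContinuousLog.of_homotopy {A : Type*} [TopologicalSpace A] (H : I × A → ℂ)
    (hH : Continuous H) (hne : ∀ p, H p ≠ 0) (h0 : HasContinuousLog fun a => H (0, a)) :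
    HasContinuousLog fun a => H (1, a) := by
  obtain ⟨L, hL, hexp⟩ := h0
  let H' : C(I × A, {z : ℂ // z ≠ 0}) := ⟨fun p => ⟨H p, hne p⟩, by fun_prop⟩
  have h0' : ∀ a, H' (0, a) = (fun z : ℂ ↦ (⟨_, z.exp_ne_zero⟩ : {z : ℂ // z ≠ 0})) (L a) :=
    fun a => Subtype.ext (hexp a).symm
  let Γ := Complex.isCoveringMap_exp.liftHomotopy H' ⟨L, hL⟩ h0'
  have hΓ := Complex.isCoveringMap_exp.liftHomotopy_lifts H' ⟨L, hL⟩ h0'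
  exact ⟨fun a => Γ (1, a), by fun_prop, fun a => congrArg Subtype.val (congrFun hΓ (1, a))⟩

theorem hasContinuousLog_const {A : Type*} [TopologicalSpace A] {c : ℂ} (hc : c ≠ 0) :
    HasContinuousLog fun _ : A => c :=
  ⟨fun _ => Complex.log c, continuous_const, fun _ => Complex.exp_log hc⟩

/-- The real plane as the complex plane. -/
noncomputable abbrev planeToComplex : ℝ × ℝ →L[ℝ] ℂ :=
  (Complex.equivRealProdCLM.symm : ℝ × ℝ →L[ℝ] ℂ)

theorem planeToComplex_ne_zero {x : ℝ × ℝ} (hx : x ≠ 0) : planeToComplex x ≠ 0 := by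
  simpa using hx

/-- The position relative to an interior point has no continuous logarithm on the frontier of a
bounded convex set. -/
theorem not_hasContinuousLog_frontier {R : Set (ℝ × ℝ)} (hconv : Convex ℝ R) (hopen : IsOpen R)
    (hbdd : Bornology.IsBounded R) {q : ℝ × ℝ} (hq : q ∈ R) :
    ¬ HasContinuousLog fun x : frontier R => planeToComplex (x.1 - q) := by
  rintro ⟨L, hL, hexp⟩
  set T : Set (ℝ × ℝ) := (fun x => x + q) ⁻¹' R with hT
  have hTconv : Convex ℝ T := hconv.translate_preimage_left q
  have hTopen : IsOpen T := hopen.preimage (by fun_prop)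
  have hT0 : T ∈ 𝓝 (0 : ℝ × ℝ) := hTopen.mem_nhds (by simpa [hT] using hq)
  have hTbdd : Bornology.IsBounded T := by
    obtain ⟨M, hM⟩ := hbdd.exists_norm_le
    refine (isBounded_iff_forall_norm_le).2 ⟨M + ‖q‖, fun x hx => ?_⟩
    have h1 := hM _ hx
    have h2 : ‖x‖ ≤ ‖x + q‖ + ‖q‖ := by
      simpa using norm_sub_le (x + q) q
    simp only at h1
    linarith
  have hfr : ∀ x, x ∈ frontier T → x + q ∈ frontier R := by
    intro x hx
    have : frontier T = (Homeomorph.addRight q) ⁻¹' frontier R :=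
      ((Homeomorph.addRight q).preimage_frontier R).symm
    rw [this] at hx
    exact hx
  have hcg := continuous_gauge hTconv hT0
  let e : ℝ → ℝ × ℝ := fun s => (Real.cos s, Real.sin s)
  have he : Continuous e := by fun_prop
  have hene : ∀ s, e s ≠ 0 := by
    intro s h
    have h1 : Real.cos s = 0 := congrArg Prod.fst h
    have h2 : Real.sin s = 0 := congrArg Prod.snd h
    have := Real.sin_sq_add_cos_sq s
    simp [h1, h2] at this
  have hg : ∀ s, 0 < gauge T (e s) := fun s =>
    (gauge_pos (absorbent_nhds_zero hT0)
      ((NormedSpace.isVonNBounded_iff ℝ).2 hTbdd)).2 (hene s)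
  have hgf : ∀ s, (gauge T (e s))⁻¹ • e s + q ∈ frontier R := by
    intro s
    refine hfr _ ((gauge_eq_one_iff_mem_frontier hTconv hT0).1 ?_)
    rw [gauge_smul_of_nonneg (inv_nonneg.2 (hg s).le), smul_eq_mul, inv_mul_cancel₀ (hg s).ne']
  -- Radial parametrization: the ray in direction `e s` meets the frontier where the gauge is one.
  let ρ : ℝ → frontier R := fun s => ⟨(gauge T (e s))⁻¹ • e s + q, hgf s⟩
  have hρ : Continuous ρ := by
    refine Continuous.subtype_mk ?_ _
    exact (((hcg.comp he).inv₀ fun s => (hg s).ne').smul he).add continuous_const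
  let θ : ℝ → ℝ := fun s => (L (ρ s)).im
  have hθ : Continuous θ := Complex.continuous_im.comp (hL.comp hρ)
  -- The imaginary part of the logarithm is an argument of the direction `e s`.
  have hpos : ∀ s, ∃ c : ℝ, 0 < c ∧ Real.cos (θ s) = c * Real.cos s ∧
      Real.sin (θ s) = c * Real.sin s := by
    intro s
    have h : Complex.exp (L (ρ s)) = planeToComplex ((gauge T (e s))⁻¹ • e s) := by
      simpa only [ρ, add_sub_cancel_right] using hexp (ρ s)
    have hre := congrArg Complex.re h
    have him := congrArg Complex.im h
    rw [map_smul, Complex.smul_re, smul_eq_mul, Complex.exp_re] at hre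
    rw [map_smul, Complex.smul_im, smul_eq_mul, Complex.exp_im] at him
    change _ = _ * Real.cos s at hre
    change _ = _ * Real.sin s at him
    have hp := Real.exp_pos (L (ρ s)).re
    refine ⟨(Real.exp (L (ρ s)).re)⁻¹ * (gauge T (e s))⁻¹, by have := hg s; positivity, ?_, ?_⟩
    · rw [mul_assoc, ← hre, inv_mul_cancel_left₀ hp.ne']
    · rw [mul_assoc, ← him, inv_mul_cancel_left₀ hp.ne']
  -- As `θ` has period 2π, `g` changes sign between 0 and π. At a zero of `g`, opposite directions
  -- would have the same argument.
  let g : ℝ → ℝ := fun s => θ s - θ (s + Real.pi)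
  have hgc : Continuous g := by fun_prop
  have hθper : ∀ s, θ (s + Real.pi + Real.pi) = θ s := by
    intro s
    have : ρ (s + Real.pi + Real.pi) = ρ s := by
      have h1 : e (s + Real.pi + Real.pi) = e s := by simp [e]
      apply Subtype.ext
      simp only [ρ, h1]
    simp only [θ, this]
  have hodd : g Real.pi = - g 0 := by
    have h := hθper 0
    simp only [g, zero_add] at h ⊢
    rw [h]; ring
  obtain ⟨s, hs⟩ : ∃ s, g s = 0 := by
    rcases le_total (g 0) 0 with h | h
    · exact mem_range_of_exists_le_of_exists_ge hgc ⟨0, h⟩ ⟨Real.pi, by linarith⟩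
    · exact mem_range_of_exists_le_of_exists_ge hgc ⟨Real.pi, by linarith⟩ ⟨0, h⟩
  have hs' : θ (s + Real.pi) = θ s := by simp only [g] at hs; linarith
  obtain ⟨c, hc, hc1, hc2⟩ := hpos s
  obtain ⟨d, hd, hd1, hd2⟩ := hpos (s + Real.pi)
  rw [hs', Real.cos_add_pi] at hd1
  rw [hs', Real.sin_add_pi] at hd2
  have h1 : (c + d) * Real.cos s = 0 := by linarith
  have h2 : (c + d) * Real.sin s = 0 := by linarith
  have hcd : c + d ≠ 0 := by positivity
  have h3 := (mul_eq_zero.1 h1).resolve_left hcd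
  have h4 := (mul_eq_zero.1 h2).resolve_left hcd
  exact hene s (Prod.ext h3 h4)

/-- A deformation retract of a plane set contains the frontier of each of the bounded convex
regions that this set encloses. -/
theorem IsDeformationRetractOf.frontier_subset {S C R : Set (ℝ × ℝ)}
    (hr : IsDeformationRetractOf S C) (hS : IsClosed S) (hC : Dense Cᶜ) (hconv : Convex ℝ R)
    (hopen : IsOpen R) (hbdd : Bornology.IsBounded R) (hRC : Disjoint R C)
    (hfr : frontier R ⊆ C) : frontier R ⊆ S := by
  intro p hp
  by_contra hpS
  obtain ⟨-, r, hrS, ⟨H⟩⟩ := hr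
  obtain ⟨ε, hε, hball⟩ := Metric.isOpen_iff.1 hS.isOpen_compl p hpS
  have hpcl : p ∈ closure R := frontier_subset_closure hp
  obtain ⟨q, hqb, hq⟩ := mem_closure_iff.1 hpcl _ Metric.isOpen_ball (Metric.mem_ball_self hε)
  -- The ball about `p` misses `S`. It contains `q` in `R` and, since `R` is the interior of its
  -- closure, also some `q'` outside the closure and off `C`.
  have hne : (Metric.ball p ε ∩ (closure R)ᶜ).Nonempty := by
    by_contra hemp
    have hsub : Metric.ball p ε ⊆ closure R := by
      intro x hx
      by_contra hx'
      exact hemp ⟨x, hx, hx'⟩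
    have : p ∈ interior (closure R) :=
      interior_maximal hsub Metric.isOpen_ball (Metric.mem_ball_self hε)
    rw [hconv.interior_closure_eq_interior_of_nonempty_interior
      ⟨q, by rwa [hopen.interior_eq]⟩] at this
    exact hp.2 this
  obtain ⟨q', ⟨hq'b, hq'cl⟩, hq'C⟩ :=
    hC.inter_open_nonempty _ (Metric.isOpen_ball.inter isClosed_closure.isOpen_compl) hne
  let i : frontier R → C := fun x => ⟨x.1, hfr x.2⟩
  have hi : Continuous i := by fun_prop
  have hsub_ne : ∀ {x y : ℝ × ℝ}, x ≠ y → planeToComplex (x - y) ≠ 0 := fun h =>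
    planeToComplex_ne_zero (sub_ne_zero.2 h)
  -- Contract the frontier to `q` inside the closure of `R`, which avoids `q'`.
  have h1 : HasContinuousLog fun x : frontier R => planeToComplex (x.1 - q') := by
    have := HasContinuousLog.of_homotopy (A := frontier R)
      (fun z => planeToComplex ((1 - (z.1 : ℝ)) • q + (z.1 : ℝ) • z.2.1 - q')) (by fun_prop)
      (fun z => hsub_ne fun h => hq'cl (h ▸ hconv.closure (subset_closure hq)
        (frontier_subset_closure z.2.2) (by unit_interval) (by unit_interval) (by ring)))
      (by
        have : q ≠ q' := fun h => hq'cl (h ▸ subset_closure hq)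
        simpa using hasContinuousLog_const (A := frontier R) (hsub_ne this))
    simpa using this
  -- Apply the retracting homotopy; it stays in `C`, hence avoids `q'`.
  have h2 : HasContinuousLog fun x : frontier R => planeToComplex ((r (i x)).1 - q') := by
    have := HasContinuousLog.of_homotopy (A := frontier R)
      (fun z => planeToComplex ((H (z.1, i z.2)).1 - q')) (by fun_prop)
      (fun z => hsub_ne fun h => hq'C (h ▸ (H (z.1, i z.2)).2)) (by simpa [i] using h1)
    simpa using this
  -- Slide `q'` to `q` within the ball, which the retracted frontier misses.
  have h3 : HasContinuousLog fun x : frontier R => planeToComplex ((r (i x)).1 - q) := by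
    have := HasContinuousLog.of_homotopy (A := frontier R)
      (fun z => planeToComplex ((r (i z.2)).1 - ((1 - (z.1 : ℝ)) • q' + (z.1 : ℝ) • q)))
      (by fun_prop)
      (fun z => hsub_ne fun h => hball (convex_ball p ε hq'b hqb
        (by unit_interval : (0 : ℝ) ≤ 1 - z.1) (by unit_interval) (by ring)) (h ▸ hrS _))
      (by simpa using h2)
    simpa using this
  refine not_hasContinuousLog_frontier hconv hopen hbdd hq ?_
  -- Run the retracting homotopy backwards, now avoiding `q`.
  have := HasContinuousLog.of_homotopy (A := frontier R)
    (fun z => planeToComplex ((H (σ z.1, i z.2)).1 - q)) (by fun_prop)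
    (fun z => hsub_ne fun h => hRC.notMem_of_mem_left hq (h ▸ (H (σ z.1, i z.2)).2))
    (by simpa using h3)
  simpa [i] using this

/-! ### The regions of the complement of a tropical plane curve -/

namespace TropicalPolynomial

variable (f : TropicalPolynomial) {a b c : ℤ × ℤ} {x y : ℝ × ℝ}

/-- The open region on which the term with exponent `a` is the unique minimal one. -/
def region (a : ℤ × ℤ) : Set (ℝ × ℝ) :=
  {x | ∀ b ∈ f.support, b ≠ a → f.term a x < f.term b x}

@[fun_prop]
theorem continuous_term (a : ℤ × ℤ) : Continuous (f.term a) := by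
  unfold term; fun_prop

theorem term_combo (a : ℤ × ℤ) {s t : ℝ} (hst : s + t = 1) :
    f.term a (s • x + t • y) = s * f.term a x + t * f.term a y := by
  obtain rfl : t = 1 - s := by linarith
  simp only [term, Prod.fst_add, Prod.snd_add, Prod.smul_fst, Prod.smul_snd, smul_eq_mul]
  ring

theorem region_eq_iInter (a : ℤ × ℤ) :
    f.region a = ⋂ b ∈ f.support.erase a, {x | f.term a x < f.term b x} := by
  ext x
  simp only [region, mem_ofPred_eq, mem_iInter, Finset.mem_erase]
  exact ⟨fun h b hb => h b hb.2 hb.1, fun h b hb hba => h b ⟨hba, hb⟩⟩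

theorem isOpen_region (a : ℤ × ℤ) : IsOpen (f.region a) := by
  rw [region_eq_iInter]
  exact isOpen_biInter_finset fun b _ => isOpen_lt (f.continuous_term a) (f.continuous_term b)

theorem convex_region (a : ℤ × ℤ) : Convex ℝ (f.region a) := by
  intro x hx y hy s t hs ht hst b hb hba
  have h1 := hx b hb hba
  have h2 := hy b hb hba
  rw [term_combo f a hst, term_combo f b hst]
  rcases hs.eq_or_lt with rfl | hs'
  · obtain rfl : t = 1 := by linarith
    linarith
  · have := mul_lt_mul_of_pos_left h1 hs'
    have := mul_le_mul_of_nonneg_left h2.le ht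
    linarith

theorem exists_mem_region_of_notMem_curve (hne : f.support.Nonempty) (hx : x ∉ f.curve) :
    ∃ a ∈ f.support, x ∈ f.region a := by
  obtain ⟨a, ha, hmin⟩ := f.support.exists_min_image (fun a => f.term a x) hne
  refine ⟨a, ha, fun b hb hba => lt_of_le_of_ne (hmin b hb) fun h => hx ?_⟩
  exact ⟨a, ⟨ha, hmin⟩, b, ⟨hb, fun c hc => h ▸ hmin c hc⟩, hba.symm⟩

theorem disjoint_region_curve (ha : a ∈ f.support) : Disjoint (f.region a) f.curve := by
  rw [Set.disjoint_left]
  rintro x hx ⟨b, hb, c, hc, hbc⟩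
  have key : ∀ d ∈ f.minimizers x, d = a := fun d hd => by
    by_contra hda
    exact absurd (hd.2 a ha) (not_le.2 (hx d hd.1 hda))
  exact hbc ((key b hb).trans (key c hc).symm)

theorem mem_minimizers_of_mem_closure_region (ha : a ∈ f.support)
    (hx : x ∈ closure (f.region a)) : a ∈ f.minimizers x := by
  refine ⟨ha, fun b hb => ?_⟩
  refine closure_minimal (t := {x | f.term a x ≤ f.term b x}) (fun y hy => ?_)
    (isClosed_le (f.continuous_term a) (f.continuous_term b)) hx
  rcases eq_or_ne b a with rfl | hba
  · exact le_refl (f.term b y)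
  · exact (hy b hb hba).le

theorem frontier_region_subset_curve (ha : a ∈ f.support) : frontier (f.region a) ⊆ f.curve := by
  intro x hx
  have hmin := f.mem_minimizers_of_mem_closure_region ha (frontier_subset_closure hx)
  have hnot : x ∉ f.region a := by
    have := hx.2
    rwa [(f.isOpen_region a).interior_eq] at this
  simp only [region, mem_ofPred_eq, not_forall, not_lt] at hnot
  obtain ⟨b, hb, hba, hle⟩ := hnot
  exact ⟨a, hmin, b, ⟨hb, fun c hc => hle.trans (hmin.2 c hc)⟩, hba.symm⟩

theorem dense_term_ne (hab : a ≠ b) : Dense {x | f.term a x ≠ f.term b x} := by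
  rw [Metric.dense_iff]
  intro x ε hε
  by_cases hx : f.term a x = f.term b x
  · rcases eq_or_ne a.1 b.1 with h1 | h1
    · have h2 : (a.2 : ℝ) ≠ b.2 := fun h => hab (Prod.ext h1 (by exact_mod_cast h))
      refine ⟨(x.1, x.2 + ε / 2), ?_, fun h => h2 ?_⟩
      · simp [Metric.mem_ball, Prod.dist_eq, abs_of_pos, hε]
      · simp only [term] at hx h
        have : ((a.2 : ℝ) - b.2) * (ε / 2) = 0 := by linarith
        have := (mul_eq_zero.1 this).resolve_right (by positivity)
        linarith
    · have h2 : (a.1 : ℝ) ≠ b.1 := by exact_mod_cast h1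
      refine ⟨(x.1 + ε / 2, x.2), ?_, fun h => h2 ?_⟩
      · simp [Metric.mem_ball, Prod.dist_eq, abs_of_pos, hε]
      · simp only [term] at hx h
        have : ((a.1 : ℝ) - b.1) * (ε / 2) = 0 := by linarith
        have := (mul_eq_zero.1 this).resolve_right (by positivity)
        linarith
  · exact ⟨x, Metric.mem_ball_self hε, hx⟩

/-- The curve lies in a countable union of closed sets with dense complement, so Baire's theorem
applies. -/
theorem dense_compl_curve : Dense f.curveᶜ := by
  have h : Dense (⋂ p ∈ {p : (ℤ × ℤ) × (ℤ × ℤ) | p.1 ≠ p.2},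
      {x | f.term p.1 x ≠ f.term p.2 x}) :=
    dense_biInter_of_isOpen
      (fun p _ => isOpen_ne_fun (f.continuous_term _) (f.continuous_term _))
      (Set.to_countable _) (fun p hp => f.dense_term_ne hp)
  refine h.mono fun x hx => ?_
  rintro ⟨a, ha, b, hb, hab⟩
  exact mem_iInter₂.1 hx (a, b) hab (le_antisymm (ha.2 b hb.1) (hb.2 a ha.1))

/-- The coordinate along the lines on which the terms with exponents `a` and `b` agree. -/
def lineCoord (a b : ℤ × ℤ) (x : ℝ × ℝ) : ℝ :=
  ((b.1 : ℝ) - a.1) * x.2 - ((b.2 : ℝ) - a.2) * x.1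

@[fun_prop]
theorem continuous_lineCoord (a b : ℤ × ℤ) : Continuous (lineCoord a b) := by
  unfold lineCoord; fun_prop

theorem sq_add_sq_pos_of_ne (hab : a ≠ b) : 0 < ((b.1 : ℝ) - a.1) ^ 2 + ((b.2 : ℝ) - a.2) ^ 2 := by
  by_contra h
  have h1 : (b.1 : ℝ) - a.1 = 0 := by
    nlinarith [sq_nonneg ((b.1 : ℝ) - a.1), sq_nonneg ((b.2 : ℝ) - a.2)]
  have h2 : (b.2 : ℝ) - a.2 = 0 := by
    nlinarith [sq_nonneg ((b.1 : ℝ) - a.1), sq_nonneg ((b.2 : ℝ) - a.2)]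
  exact hab (Prod.ext (by exact_mod_cast (sub_eq_zero.1 h1).symm)
    (by exact_mod_cast (sub_eq_zero.1 h2).symm))

/-- The linear parts of `lineCoord a b` and of the difference of the terms form a scaled rotation,
of determinant `p ^ 2 + q ^ 2`. -/
theorem lineCoord_injOn (hab : a ≠ b) :
    InjOn (lineCoord a b) {x | f.term a x = f.term b x} := by
  intro x hx y hy h
  have hpos := sq_add_sq_pos_of_ne hab
  simp only [mem_ofPred_eq, term, lineCoord] at hx hy h
  set p := (b.1 : ℝ) - a.1 with hp
  set q := (b.2 : ℝ) - a.2 with hq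
  have h1 : p * (x.1 - y.1) + q * (x.2 - y.2) = 0 := by rw [hp, hq]; linarith
  have h2 : p * (x.2 - y.2) - q * (x.1 - y.1) = 0 := by linarith
  have h3 : (p ^ 2 + q ^ 2) * (x.1 - y.1) = 0 := by linear_combination p * h1 - q * h2
  have h4 : (p ^ 2 + q ^ 2) * (x.2 - y.2) = 0 := by linear_combination q * h1 + p * h2
  exact Prod.ext (sub_eq_zero.1 ((mul_eq_zero.1 h3).resolve_left hpos.ne'))
    (sub_eq_zero.1 ((mul_eq_zero.1 h4).resolve_left hpos.ne'))

/-- If the terms `a` and `b` agree at two distinct points `k`, `k'`, and the three terms `a`, `b`,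
`c` agree at both of them, then `c - a` is a multiple of `b - a`. -/
theorem exists_term_sub_eq_mul {k k' : ℝ × ℝ} (hab : a ≠ b)
    (hk : f.term a k = f.term b k) (hk' : f.term a k' = f.term b k') (hkk' : k ≠ k')
    (hc : f.term c k = f.term a k) (hc' : f.term c k' = f.term a k') :
    ∃ r : ℝ, ∀ x, f.term c x - f.term a x = r * (f.term b x - f.term a x) := by
  have hpos := sq_add_sq_pos_of_ne hab
  have hφ : lineCoord a b k - lineCoord a b k' ≠ 0 := fun h =>
    hkk' (f.lineCoord_injOn hab hk hk' (sub_eq_zero.1 h))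
  simp only [term, lineCoord] at hk hk' hc hc' hφ
  set p := (b.1 : ℝ) - a.1 with hp
  set q := (b.2 : ℝ) - a.2 with hq
  set u := (c.1 : ℝ) - a.1 with hu
  set v := (c.2 : ℝ) - a.2 with hv
  have e1 : p * (k.1 - k'.1) + q * (k.2 - k'.2) = 0 := by rw [hp, hq]; linarith
  have e2 : u * (k.1 - k'.1) + v * (k.2 - k'.2) = 0 := by rw [hu, hv]; linarith
  -- Both exponent differences are orthogonal to `k - k'`, hence parallel; `r` below is the
  -- projection coefficient.
  have e3 : u * q - v * p = 0 := by
    refine (mul_eq_zero.1 (?_ : (u * q - v * p) *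
      (p * k.2 - q * k.1 - (p * k'.2 - q * k'.1)) = 0)).resolve_right hφ
    linear_combination (-(p ^ 2 + q ^ 2)) * e2 + (u * p + v * q) * e1
  refine ⟨(u * p + v * q) / (p ^ 2 + q ^ 2), fun x => ?_⟩
  have hbk : f.coeff b - f.coeff a = -(p * k.1 + q * k.2) := by rw [hp, hq]; linarith
  have hck : f.coeff c - f.coeff a = -(u * k.1 + v * k.2) := by rw [hu, hv]; linarith
  have h1 : f.term c x - f.term a x = u * (x.1 - k.1) + v * (x.2 - k.2) := by
    simp only [term]; rw [hu, hv] at *; linarith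
  have h2 : f.term b x - f.term a x = p * (x.1 - k.1) + q * (x.2 - k.2) := by
    simp only [term]; rw [hp, hq] at *; linarith
  rw [h1, h2, div_mul_eq_mul_div, eq_div_iff hpos.ne']
  linear_combination (q * (x.1 - k.1) - p * (x.2 - k.2)) * e3

/-- Near a point in the relative interior of the common edge of two regions, the tropical curve is
contained in the line through this edge. -/
theorem eventually_term_eq_of_mem_curve {k k' v : ℝ × ℝ} (hab : a ≠ b)
    (hra : (f.region a).Nonempty) (hrb : (f.region b).Nonempty)
    (hk : a ∈ f.minimizers k ∧ b ∈ f.minimizers k)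
    (hk' : a ∈ f.minimizers k' ∧ b ∈ f.minimizers k')
    (hv : a ∈ f.minimizers v ∧ b ∈ f.minimizers v)
    (h1 : lineCoord a b k < lineCoord a b v) (h2 : lineCoord a b v < lineCoord a b k') :
    ∀ᶠ x in 𝓝 v, x ∈ f.curve → f.term a x = f.term b x := by
  have heq : ∀ {z}, a ∈ f.minimizers z ∧ b ∈ f.minimizers z → f.term a z = f.term b z :=
    fun h => le_antisymm (h.1.2 _ h.2.1) (h.2.2 _ h.1.1)
  have hsupa := hk.1.1
  have hsupb := hk.2.1
  have key : ∀ c ∈ f.support, c ≠ a → c ≠ b → ∀ᶠ x in 𝓝 v, f.term a x ≠ f.term b x →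
      min (f.term a x) (f.term b x) < f.term c x := by
    intro c hc hca hcb
    by_cases hcv : c ∈ f.minimizers v
    · refine Filter.Eventually.of_forall fun x hx => ?_
      have hcav : f.term c v = f.term a v := le_antisymm (hcv.2 _ hsupa) (hv.1.2 _ hc)
      -- Write `v` as a proper convex combination of `k` and `k'`. The affine function `c - a` is
      -- nonnegative at both and zero at `v`, so it vanishes at both.
      set d := lineCoord a b k' - lineCoord a b k with hd
      have hdpos : 0 < d := by rw [hd]; linarith
      set s := (lineCoord a b k' - lineCoord a b v) / d with hs
      set t := (lineCoord a b v - lineCoord a b k) / d with ht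
      have hspos : 0 < s := div_pos (by linarith) hdpos
      have htpos : 0 < t := div_pos (by linarith) hdpos
      have hst : s + t = 1 := by
        rw [hs, ht, ← add_div, div_eq_one_iff_eq hdpos.ne', hd]; ring
      have hvk : v = s • k + t • k' := by
        refine f.lineCoord_injOn hab (heq hv) ?_ ?_
        · simp only [mem_ofPred_eq, term_combo f _ hst, heq hk, heq hk']
        · have : lineCoord a b (s • k + t • k') = s * lineCoord a b k + t * lineCoord a b k' := by
            simp only [lineCoord, Prod.fst_add, Prod.snd_add, Prod.smul_fst, Prod.smul_snd,
              smul_eq_mul]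
            ring
          rw [this, hs, ht]
          field_simp
          rw [hd]; ring
      have hck := hk.1.2 c hc
      have hck' := hk'.1.2 c hc
      rw [hvk, term_combo f c hst, term_combo f a hst] at hcav
      have e1 : f.term c k = f.term a k := by
        refine le_antisymm ?_ hck
        by_contra! hlt
        have := mul_lt_mul_of_pos_left hlt hspos
        have := mul_le_mul_of_nonneg_left hck' htpos.le
        linarith
      have e2 : f.term c k' = f.term a k' := by
        rw [e1] at hcav
        exact mul_left_cancel₀ htpos.ne' (by linarith)
      obtain ⟨r, hr⟩ := f.exists_term_sub_eq_mul hab (heq hk) (heq hk')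
        (fun h => by rw [h] at h1; linarith) e1 e2
      obtain ⟨y, hy⟩ := hra
      obtain ⟨z, hz⟩ := hrb
      -- Evaluating in the two regions gives `0 < r < 1`: off the line, term `c` lies strictly
      -- between the other two.
      have hr0 : 0 < r := by
        have ha1 := hy c hc hca
        have ha2 := hy b hsupb hab.symm
        exact pos_of_mul_pos_left (by linarith [hr y] : 0 < r * (f.term b y - f.term a y))
          (by linarith)
      have hr1 : r < 1 := by
        have ha1 := hz c hc hcb
        have ha2 := hz a hsupa hab
        by_contra! hge
        nlinarith [hr z]
      have hrx := hr x
      rcases lt_or_gt_of_ne hx with hlt | hlt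
      · refine (min_le_left _ _).trans_lt ?_
        nlinarith
      · refine (min_le_right _ _).trans_lt ?_
        nlinarith
    · have hlt : f.term a v < f.term c v := by
        refine lt_of_le_of_ne (hv.1.2 c hc) fun h => hcv ⟨hc, fun d hd => h ▸ hv.1.2 d hd⟩
      filter_upwards [(f.continuous_term a).continuousAt.eventually_lt
        (f.continuous_term c).continuousAt hlt] with x hx _
      exact (min_le_left _ _).trans_lt hx
  have hall : ∀ᶠ x in 𝓝 v, ∀ c ∈ f.support, c ≠ a → c ≠ b → f.term a x ≠ f.term b x →
      min (f.term a x) (f.term b x) < f.term c x := by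
    rw [Filter.eventually_all_finset]
    intro c hc
    by_cases hca : c = a
    · exact Filter.Eventually.of_forall fun x h => absurd hca h
    by_cases hcb : c = b
    · exact Filter.Eventually.of_forall fun x _ h => absurd hcb h
    filter_upwards [key c hc hca hcb] with x hx _ _
    exact hx
  filter_upwards [hall] with x hx hcurve
  by_contra hne
  obtain ⟨c, hc, d, hd, hcd⟩ := hcurve
  have hmem : ∀ c ∈ f.minimizers x, c = a ∨ c = b := by
    intro c hc
    by_contra! h
    have := hx c hc.1 h.1 h.2 hne
    exact absurd this (not_lt.2 (le_min (hc.2 a hsupa) (hc.2 b hsupb)))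
  have h3 := hc.2 d hd.1
  have h4 := hd.2 c hc.1
  rcases hmem c hc with rfl | rfl <;> rcases hmem d hd with rfl | rfl
  · exact hcd rfl
  · exact hne (le_antisymm h3 h4)
  · exact hne (le_antisymm h4 h3)
  · exact hcd rfl

end TropicalPolynomial

/-! ### Arcs on a line -/

/-- A continuous function on the unit interval that is injective on its interior exceeds its value
at an interior point at one of the two ends. -/
theorem lt_apply_zero_or_lt_apply_one {ψ : I → ℝ} (hψ : Continuous ψ) (hinj : InjOn ψ (Ioo 0 1))
    {m : I} (hm : m ∈ Ioo (0 : I) 1) : ψ m < ψ 0 ∨ ψ m < ψ 1 := by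
  rcases hψ.continuousOn.strictMonoOn_of_injOn_Ioo zero_lt_one hinj with h | h
  -- The intermediate `n` keeps the inequality strict in the limit at the end of the interval.
  · obtain ⟨n, hmn, hn⟩ := exists_between hm.2
    have hn' : n ∈ Ioo (0 : I) 1 := ⟨hm.1.trans hmn, hn⟩
    refine Or.inr ((h hm hn' hmn).trans_le ?_)
    have : (1 : I) ∈ closure (Ioo n 1) := by
      rw [closure_Ioo hn.ne]; exact ⟨hn.le, le_rfl⟩
    exact closure_minimal (t := {x | ψ n ≤ ψ x})
      (fun x hx => (h hn' ⟨hn'.1.trans hx.1, hx.2⟩ hx.1).le)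
      (isClosed_le continuous_const hψ) this
  · obtain ⟨n, hn, hmn⟩ := exists_between hm.1
    have hn' : n ∈ Ioo (0 : I) 1 := ⟨hn, hmn.trans hm.2⟩
    refine Or.inl ((h hn' hm hmn).trans_le ?_)
    have : (0 : I) ∈ closure (Ioo 0 n) := by
      rw [closure_Ioo hn.ne]; exact ⟨le_rfl, hn.le⟩
    exact closure_minimal (t := {x | ψ n ≤ ψ x})
      (fun x hx => (h ⟨hx.1, hx.2.trans hn'.2⟩ hn' hx.2).le)
      (isClosed_le continuous_const hψ) this

/-- Two arcs in a set that is parametrized by a real coordinate and that start at the same point, on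
the same side, overlap. -/
theorem exists_eq_of_coord_pos {X : Type*} [TopologicalSpace X] {φ : X → ℝ} {T : Set X}
    (hφ : InjOn φ T) {γ γ' : ℝ → X} {δ : ℝ} (hδ : 0 < δ) (hγ' : ContinuousOn (φ ∘ γ') (Icc 0 δ))
    (hT : ∀ t ∈ Icc 0 δ, γ t ∈ T) (hT' : ∀ t ∈ Icc 0 δ, γ' t ∈ T)
    (h : φ (γ' 0) < φ (γ δ)) (hle : φ (γ δ) ≤ φ (γ' δ)) :
    ∃ t ∈ Ioc 0 δ, γ δ = γ' t := by
  obtain ⟨t, ht, hteq⟩ := intermediate_value_Icc hδ.le hγ' ⟨h.le, hle⟩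
  have ht0 : t ≠ 0 := by
    rintro rfl
    exact h.ne hteq
  exact ⟨t, ⟨lt_of_le_of_ne ht.1 ht0.symm, ht.2⟩,
    hφ (hT δ ⟨hδ.le, le_rfl⟩) (hT' t ht) hteq.symm⟩

/-- In a set that is locally parametrized by a real coordinate, there are no three arcs that start
at the same point and are disjoint otherwise. -/
theorem not_three_arcs {X : Type*} [TopologicalSpace X] {v : X} {φ : X → ℝ} (hφ : Continuous φ)
    {S N : Set X} (hN : N ∈ 𝓝 v) (hinj : InjOn φ (S ∩ N)) {η : ℝ} (hη : 0 < η) (γ : Fin 3 → ℝ → X)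
    (hγ : ∀ i, Continuous (γ i)) (hv : ∀ i, γ i 0 = v) (hS : ∀ i t, γ i t ∈ S)
    (hne : ∀ i, ∀ t ∈ Ioc 0 η, γ i t ≠ v)
    (hdisj : ∀ i j, i ≠ j → ∀ s ∈ Ioc 0 η, ∀ t ∈ Ioc 0 η, γ i s ≠ γ j t) : False := by
  have h1 : ∀ᶠ t in 𝓝 (0 : ℝ), ∀ i, γ i t ∈ N := by
    rw [Filter.eventually_all]
    intro i
    exact (hγ i).continuousAt.preimage_mem_nhds (by rwa [hv i])
  obtain ⟨δ', hδ', hball⟩ := Metric.eventually_nhds_iff.1 h1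
  obtain ⟨δ, hδ, hδlt⟩ := exists_between (lt_min hδ' hη)
  have hδη : δ ≤ η := (hδlt.trans_le (min_le_right _ _)).le
  have hT : ∀ i, ∀ t ∈ Icc 0 δ, γ i t ∈ S ∩ N := fun i t ht => ⟨hS i t, hball (by
    rw [Real.dist_eq, sub_zero, abs_of_nonneg ht.1]
    exact ht.2.trans_lt (hδlt.trans_le (min_le_left _ _))) i⟩
  have hδ0 : ∀ i, φ (γ i δ) ≠ φ v := fun i h => hne i δ ⟨hδ, hδη⟩
    (hinj (hT i δ ⟨hδ.le, le_rfl⟩) (hv i ▸ hT i 0 ⟨le_rfl, hδ.le⟩) h)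
  -- Two of the three arcs are on the same side of `v` at time `δ`; by the intermediate value
  -- theorem the one that got further passes through the other's position.
  obtain ⟨i, j, hij, hP⟩ := Fintype.exists_ne_map_eq_of_card_lt
    (fun i : Fin 3 => (φ v < φ (γ i δ) : Prop)) (by simp)
  have key : ∀ ψ : X → ℝ, Continuous ψ → InjOn ψ (S ∩ N) → ∀ i j, i ≠ j →
      ψ v < ψ (γ i δ) → ψ (γ i δ) ≤ ψ (γ j δ) → False := by
    intro ψ hψ hψi i j hij h hle
    obtain ⟨t, ht, heq⟩ := exists_eq_of_coord_pos hψi hδ (hψ.comp (hγ j)).continuousOn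
      (hT i) (hT j) (by rwa [hv j]) hle
    exact hdisj i j hij δ ⟨hδ, hδη⟩ t ⟨ht.1, ht.2.trans hδη⟩ heq
  have key2 : ∀ ψ : X → ℝ, Continuous ψ → InjOn ψ (S ∩ N) →
      ψ v < ψ (γ i δ) → ψ v < ψ (γ j δ) → False := by
    intro ψ hψ hψi h h'
    rcases le_total (ψ (γ i δ)) (ψ (γ j δ)) with hle | hle
    · exact key ψ hψ hψi i j hij h hle
    · exact key ψ hψ hψi j i hij.symm h' hle
  have hP' : φ v < φ (γ i δ) ↔ φ v < φ (γ j δ) := iff_of_eq hP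
  by_cases h : φ v < φ (γ i δ)
  · exact key2 φ hφ hinj h (hP'.1 h)
  · have hi := lt_of_le_of_ne (not_lt.1 h) (hδ0 i)
    have hj := lt_of_le_of_ne (not_lt.1 fun h' => h (hP'.2 h')) (hδ0 j)
    exact key2 (fun x => -φ x) hφ.neg (fun x hx y hy h => hinj hx hy (neg_injective h))
      (neg_lt_neg hi) (neg_lt_neg hj)

/-! ### Half-edges of an embedded graph -/

namespace PlaneEmbedding

variable {α β : Type*} {G : Graph α β} (D : PlaneEmbedding G)

/-- The arc of an edge, run through from the start (`true`) or from the end (`false`). -/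
noncomputable def halfArc (p : β × Bool) (t : ℝ) : ℝ × ℝ :=
  D.arc p.1 (projIcc 0 1 zero_le_one (bif p.2 then t else 1 - t))

theorem continuous_halfArc (p : β × Bool) : Continuous (D.halfArc p) := by
  unfold halfArc
  refine (D.arc p.1).continuous.comp (continuous_projIcc.comp ?_)
  cases p.2 <;> simp only [cond_true, cond_false] <;> fun_prop

theorem halfArc_mem_image {p : β × Bool} (hp : p.1 ∈ G.edgeSet) (t : ℝ) :
    D.halfArc p t ∈ D.image :=
  Or.inr (mem_biUnion hp (mem_range_self _))

theorem exists_halfArc_eq {p : β × Bool} {t : ℝ} (ht : t ∈ Ioc (0 : ℝ) (1 / 3)) :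
    ∃ s ∈ Ioo (0 : I) 1, D.halfArc p t = D.arc p.1 s ∧
      (s : ℝ) = bif p.2 then t else 1 - t := by
  obtain ⟨e, b⟩ := p
  have hmem : (bif b then t else 1 - t) ∈ Ioo (0 : ℝ) 1 := by
    cases b <;> constructor <;> simp only [cond_true, cond_false] <;> linarith [ht.1, ht.2]
  refine ⟨⟨_, Ioo_subset_Icc_self hmem⟩, ⟨hmem.1, hmem.2⟩, ?_, rfl⟩
  simp only [halfArc]
  rw [projIcc_of_mem zero_le_one (Ioo_subset_Icc_self hmem)]

theorem halfArc_ne_pt {p : β × Bool} (hp : p.1 ∈ G.edgeSet) {t : ℝ}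
    (ht : t ∈ Ioc (0 : ℝ) (1 / 3)) {v : α} (hv : v ∈ G.vertexSet) : D.halfArc p t ≠ D.pt v := by
  obtain ⟨s, hs, h, -⟩ := D.exists_halfArc_eq (p := p) ht
  rw [h]
  exact D.arc_ne_pt _ hp s hs v hv

/-- Since `1 / 3` is less than one half, even the two half-edges of a single edge stay apart. -/
theorem halfArc_ne_halfArc {p q : β × Bool} (hp : p.1 ∈ G.edgeSet) (hq : q.1 ∈ G.edgeSet)
    (hpq : p ≠ q) {s t : ℝ} (hs : s ∈ Ioc (0 : ℝ) (1 / 3)) (ht : t ∈ Ioc (0 : ℝ) (1 / 3)) :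
    D.halfArc p s ≠ D.halfArc q t := by
  obtain ⟨s', hs', h1, h2⟩ := D.exists_halfArc_eq (p := p) hs
  obtain ⟨t', ht', h3, h4⟩ := D.exists_halfArc_eq (p := q) ht
  rw [h1, h3]
  obtain ⟨e, b⟩ := p
  obtain ⟨e', b'⟩ := q
  by_cases hee : e = e'
  · subst hee
    intro h
    have hst : (s' : ℝ) = t' := congrArg _ (D.arc_injOn e hp hs' ht' h)
    rw [h2, h4] at hst
    obtain ⟨hs0, hs1⟩ := hs
    obtain ⟨ht0, ht1⟩ := ht
    cases b <;> cases b' <;> simp only [cond_true, cond_false] at hst <;>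
      first | exact hpq rfl | linarith
  · exact D.arc_ne_arc e hp e' hq hee s' hs' t' ht'

/-- There are at least as many half-edges at a vertex as its degree says. -/
theorem vertexDegree_le_encard (v : α) :
    G.vertexDegree v ≤ {p : β × Bool | p.1 ∈ G.edgeSet ∧ D.halfArc p 0 = D.pt v}.encard := by
  classical
  have h0 : ∀ e, D.halfArc (e, true) 0 = D.arc e 0 := fun e => by simp [halfArc]
  have h1 : ∀ e, D.halfArc (e, false) 0 = D.arc e 1 := fun e => by simp [halfArc]
  have hinc : ∀ e ∈ G.incidenceSet v, ∃ b, D.halfArc (e, b) 0 = D.pt v := by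
    intro e he
    obtain ⟨u, w, hl, hu, hw⟩ := D.arc_ends e (G.incidenceSet_subset_edgeSet v he)
    rcases Graph.Inc.eq_or_eq_of_isLink he hl with rfl | rfl
    · exact ⟨true, by rw [h0, hu]⟩
    · exact ⟨false, by rw [h1, hw]⟩
  have hloop : ∀ e ∈ G.loopSet v, ∀ b, D.halfArc (e, b) 0 = D.pt v := by
    intro e he
    obtain ⟨u, w, hl, hu, hw⟩ := D.arc_ends e (Graph.IsLoopAt.edge_mem he)
    have hvu := Graph.IsLoopAt.eq_of_inc he hl.inc_left
    have hvw := Graph.IsLoopAt.eq_of_inc he hl.inc_right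
    rintro (_ | _)
    · rw [h1, hw, hvw]
    · rw [h0, hu, hvu]
  choose! b hb using hinc
  -- Each incident edge contributes one half-edge, and a loop also the opposite one.
  have hi1 : InjOn (fun e => (e, b e)) (G.incidenceSet v) := fun _ _ _ _ h => (Prod.ext_iff.1 h).1
  have hi2 : InjOn (fun e => (e, !b e)) (G.loopSet v) := fun _ _ _ _ h => (Prod.ext_iff.1 h).1
  have hd : Disjoint ((fun e => (e, b e)) '' G.incidenceSet v)
      ((fun e => (e, !b e)) '' G.loopSet v) := by
    rw [Set.disjoint_left]
    rintro _ ⟨e, -, rfl⟩ ⟨e', -, h⟩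
    simp only [Prod.mk.injEq] at h
    obtain ⟨rfl, h⟩ := h
    simp at h
  rw [Graph.vertexDegree, ← hi1.encard_image, ← hi2.encard_image, ← Set.encard_union_eq hd]
  refine Set.encard_le_encard (union_subset ?_ ?_)
  · rintro _ ⟨e, he, rfl⟩
    exact ⟨G.incidenceSet_subset_edgeSet v he, hb e he⟩
  · rintro _ ⟨e, he, rfl⟩
    exact ⟨Graph.IsLoopAt.edge_mem he, hloop e he _⟩

/-- Near a vertex of degree three, an embedded graph is not contained in a set that is parametrized
by a real coordinate. -/
theorem not_injOn_image_of_vertexDegree_eq_three {v : α} (hv : v ∈ G.vertexSet)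
    (hdeg : G.vertexDegree v = 3) {φ : ℝ × ℝ → ℝ} (hφ : Continuous φ) {N : Set (ℝ × ℝ)}
    (hN : N ∈ 𝓝 (D.pt v)) : ¬ InjOn φ (D.image ∩ N) := by
  intro hinj
  obtain ⟨T, hT, hT3⟩ := Set.exists_subset_encard_eq (hdeg ▸ D.vertexDegree_le_encard v)
  obtain ⟨x, y, z, hxy, hxz, hyz, rfl⟩ := Set.encard_eq_three.1 hT3
  have hmem : ∀ i, (![x, y, z] : Fin 3 → β × Bool) i ∈
      {p : β × Bool | p.1 ∈ G.edgeSet ∧ D.halfArc p 0 = D.pt v} := by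
    intro i
    fin_cases i <;> exact hT (by simp)
  have hne : ∀ i j, i ≠ j → (![x, y, z] : Fin 3 → β × Bool) i ≠ ![x, y, z] j := by
    intro i j
    fin_cases i <;> fin_cases j <;> simp [hxy, hxz, hyz, hxy.symm, hxz.symm, hyz.symm]
  exact not_three_arcs hφ hN hinj (η := 1 / 3) (by norm_num) (fun i => D.halfArc (![x, y, z] i))
    (fun i => D.continuous_halfArc _) (fun i => (hmem i).2)
    (fun i => D.halfArc_mem_image (hmem i).1) (fun i t ht => D.halfArc_ne_pt (hmem i).1 ht hv)
    (fun i j hij s hs t ht => D.halfArc_ne_halfArc (hmem i).1 (hmem j).1 (hne i j hij) hs ht)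

theorem isCompact_image (hV : G.vertexSet.Finite) (hE : G.edgeSet.Finite) :
    IsCompact D.image :=
  (hV.image _).isCompact.union (hE.isCompact_biUnion fun e _ => isCompact_range (D.arc e).continuous)

/-- Two different edges whose arcs lie in a set that is parametrized by a real coordinate have an
end with a coordinate strictly between those of two points of the arcs. -/
theorem exists_vertex_between {e e' : β} (he : e ∈ G.edgeSet) (he' : e' ∈ G.edgeSet)
    (hee' : e ≠ e') {K : Set (ℝ × ℝ)} (hK : range (D.arc e) ⊆ K) (hK' : range (D.arc e') ⊆ K)
    {φ : ℝ × ℝ → ℝ} (hφ : Continuous φ) (hinj : InjOn φ K) :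
    ∃ v ∈ G.vertexSet, D.pt v ∈ K ∧ ∃ k ∈ K, ∃ k' ∈ K, φ k < φ (D.pt v) ∧ φ (D.pt v) < φ k' := by
  obtain ⟨m, hm⟩ := exists_between (zero_lt_one (α := I))
  have hKm : ∀ t, D.arc e t ∈ K := fun t => hK (mem_range_self t)
  have hKm' : ∀ t, D.arc e' t ∈ K := fun t => hK' (mem_range_self t)
  wlog hlt : φ (D.arc e m) < φ (D.arc e' m) generalizing e e'
  · refine this he' he hee'.symm hK' hK hKm' hKm (lt_of_le_of_ne (not_lt.1 hlt) fun h => ?_)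
    exact D.arc_ne_arc e he e' he' hee' m hm m hm (hinj (hKm m) (hKm' m) h.symm)
  obtain ⟨u, w, hl, hu, hw⟩ := D.arc_ends e he
  have hcont : Continuous fun t => φ (D.arc e t) := hφ.comp (D.arc e).continuous
  -- The arc of `e` never passes the interior point `m` of the other arc, so its coordinate stays
  -- below. One of its ends lies beyond its own point at `m`, and this end is the required vertex.
  have hne : ∀ t, φ (D.arc e t) ≠ φ (D.arc e' m) := by
    intro t ht
    have heq := hinj (hKm t) (hKm' m) ht
    rcases eq_or_ne t 0 with rfl | h0
    · exact D.arc_ne_pt e' he' m hm u hl.left_mem (heq.symm.trans hu)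
    rcases eq_or_ne t 1 with rfl | h1
    · exact D.arc_ne_pt e' he' m hm w hl.right_mem (heq.symm.trans hw)
    exact D.arc_ne_arc e he e' he' hee' t ⟨unitInterval.pos_iff_ne_zero.2 h0,
      unitInterval.lt_one_iff_ne_one.2 h1⟩ m hm heq
  have hlt' : ∀ t, φ (D.arc e t) < φ (D.arc e' m) := by
    intro t
    by_contra! hge
    obtain ⟨s, hs⟩ := mem_range_of_exists_le_of_exists_ge hcont ⟨m, hlt.le⟩ ⟨t, hge⟩
    exact hne s hs
  have hinj' : InjOn (fun t => φ (D.arc e t)) (Ioo 0 1) := fun s hs t ht h =>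
    D.arc_injOn e he hs ht (hinj (hKm s) (hKm t) h)
  rcases lt_apply_zero_or_lt_apply_one hcont hinj' hm with h | h
  · exact ⟨u, hl.left_mem, hu ▸ hKm 0, _, hKm m, _, hKm' m, hu ▸ h, hu ▸ hlt' 0⟩
  · exact ⟨w, hl.right_mem, hw ▸ hKm 1, _, hKm m, _, hKm' m, hw ▸ h, hw ▸ hlt' 1⟩

end PlaneEmbedding

/-! ### Bounded faces of the skeleton of a tropical plane curve -/

theorem PlaneEmbedding.IsBoundedFace.nonempty {α β : Type*} {G : Graph α β}
    {D : PlaneEmbedding G} {F : Set (ℝ × ℝ)} (hF : D.IsBoundedFace F) : F.Nonempty := by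
  obtain ⟨⟨x, hx, rfl⟩, -⟩ := hF
  exact ⟨x, mem_connectedComponentIn hx⟩

/-- A deformation retract of a tropical curve, embedded as a finite graph, has as bounded faces
only bounded regions of the complement of the curve. -/
theorem PlaneEmbedding.IsBoundedFace.exists_eq_region {α β : Type*} {G : Graph α β}
    {D : PlaneEmbedding G} (hclosed : IsClosed D.image) {f : TropicalPolynomial}
    (hne : f.support.Nonempty) (hr : IsDeformationRetractOf D.image f.curve)
    {F : Set (ℝ × ℝ)} (hF : D.IsBoundedFace F) : ∃ a ∈ f.support, F = f.region a := by
  obtain ⟨⟨x, hx, rfl⟩, hbdd⟩ := hF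
  have hopen : IsOpen (connectedComponentIn D.imageᶜ x) :=
    hclosed.isOpen_compl.connectedComponentIn
  obtain ⟨y, hyF, hyC⟩ := f.dense_compl_curve.inter_open_nonempty _ hopen
    ⟨x, mem_connectedComponentIn hx⟩
  obtain ⟨a, ha, hya⟩ := f.exists_mem_region_of_notMem_curve hne hyC
  have hdisj := f.disjoint_region_curve ha
  have hsub : f.region a ⊆ D.imageᶜ := fun z hz hzD => hdisj.notMem_of_mem_left hz (hr.1 hzD)
  have hle : f.region a ⊆ connectedComponentIn D.imageᶜ x := by
    rw [connectedComponentIn_eq hyF]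
    exact (f.convex_region a).isPreconnected.subset_connectedComponentIn hya hsub
  refine ⟨a, ha, Subset.antisymm ?_ hle⟩
  have hfr := hr.frontier_subset hclosed f.dense_compl_curve (f.convex_region a)
    (f.isOpen_region a) (hbdd.subset hle) hdisj (f.frontier_region_subset_curve ha)
  -- The frontier of the region lies in the graph, so the connected face cannot leave the region.
  refine isPreconnected_connectedComponentIn.subset_left_of_subset_union (f.isOpen_region a)
    isClosed_closure.isOpen_compl (disjoint_compl_right.mono_left subset_closure) (fun z hz => ?_)
    ⟨y, hyF, hya⟩
  by_contra hz'
  rw [mem_union, not_or, mem_compl_iff, not_not] at hz'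
  refine connectedComponentIn_subset _ _ hz (hfr ⟨hz'.2, ?_⟩)
  rw [(f.isOpen_region a).interior_eq]
  exact hz'.1

/-- An open convex set does not lie on both sides of an edge that is disjoint from it and contained
in a set with dense complement. -/
theorem PlaneEmbedding.not_onBothSides {α β : Type*} {G : Graph α β} {D : PlaneEmbedding G}
    {C F : Set (ℝ × ℝ)} (hDC : D.image ⊆ C) (hC : Dense Cᶜ) (hF : Convex ℝ F) (hFo : IsOpen F)
    (hFD : Disjoint F C) (hFne : F.Nonempty) (e : β) : ¬ D.OnBothSides e F := by
  rintro ⟨he, h⟩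
  obtain ⟨t, ht⟩ := exists_between (zero_lt_one (α := I))
  have harc : range (D.arc e) ⊆ C := (subset_biUnion_of_mem (u := fun e => range (D.arc e)) he).trans
    (subset_union_right.trans hDC)
  -- Near this point everything off `C` belongs to `F`, and such points are dense.
  have hcl : D.arc e t ∈ interior (closure F) := by
    refine mem_interior_iff_mem_nhds.2 ?_
    obtain ⟨U, hU, hUo, htU⟩ := mem_nhds_iff.1 (h t ht)
    refine Filter.mem_of_superset (hUo.mem_nhds htU) fun x hx => ?_
    rw [mem_closure_iff]
    intro V hV hxV
    obtain ⟨y, ⟨hyV, hyU⟩, hyC⟩ := hC.inter_open_nonempty _ (hV.inter hUo) ⟨x, hxV, hx⟩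
    exact ⟨y, hyV, (hU hyU).resolve_right fun hy => hyC (harc hy)⟩
  rw [hF.interior_closure_eq_interior_of_nonempty_interior (by rwa [hFo.interior_eq]),
    hFo.interior_eq] at hcl
  exact hFD.notMem_of_mem_left hcl (harc (mem_range_self t))

/-- Crowded graphs are not skeletons of smooth tropical plane curves. The regions of the complement
of any tropical plane curve are convex, and two of them meet in at most one edge, so that the
smoothness of the curve is not needed. -/
theorem mainTheorem4 {α β : Type*} (G : Graph α β) (hG : G.IsCrowded)
    (f : TropicalPolynomial) (hf : f.IsSmooth) : ¬ f.HasSkeletonGraph G := by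
  rintro ⟨S, hS, D, rfl⟩
  obtain ⟨hG3, -, hcrowded⟩ := hG
  have hr : IsDeformationRetractOf D.image f.curve := hS.prop.2
  have hclosed := (D.isCompact_image hG3.finite_vertexSet hG3.finite_edgeSet).isClosed
  have hne : f.support.Nonempty := by
    obtain ⟨v, hv⟩ := hG3.nonempty
    obtain ⟨a, ha, -⟩ := hr.1 (Or.inl (mem_image_of_mem D.pt hv))
    exact ⟨a, ha.1⟩
  rcases hcrowded D with ⟨F, F', hF, hF', hFF', e, e', hee', heF, heF', he'F, he'F'⟩ |
    ⟨F, hF, e, he⟩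
  · obtain ⟨a, ha, rfl⟩ := hF.exists_eq_region hclosed hne hr
    obtain ⟨b, hb, rfl⟩ := hF'.exists_eq_region hclosed hne hr
    have hab : a ≠ b := fun h => hFF' (h ▸ rfl)
    let K : Set (ℝ × ℝ) := {x | a ∈ f.minimizers x ∧ b ∈ f.minimizers x}
    have hsub : ∀ {e}, D.Borders e (f.region a) → D.Borders e (f.region b) →
        range (D.arc e) ⊆ K := fun h h' x hx =>
      ⟨f.mem_minimizers_of_mem_closure_region ha (frontier_subset_closure (h.2 hx)),
        f.mem_minimizers_of_mem_closure_region hb (frontier_subset_closure (h'.2 hx))⟩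
    have hKline : K ⊆ {x | f.term a x = f.term b x} := fun x hx =>
      le_antisymm (hx.1.2 b hb) (hx.2.2 a ha)
    -- On `K` the two terms agree, so `lineCoord a b` is injective there and orders the points of
    -- the two shared edges.
    obtain ⟨v, hv, hvK, k, hk, k', hk', h1, h2⟩ := D.exists_vertex_between heF.1 he'F.1 hee'
      (hsub heF heF') (hsub he'F he'F') (TropicalPolynomial.continuous_lineCoord a b)
      ((f.lineCoord_injOn hab).mono hKline)
    have hev := f.eventually_term_eq_of_mem_curve hab hF.nonempty hF'.nonempty hk hk' hvK h1 h2
    exact D.not_injOn_image_of_vertexDegree_eq_three hv (hG3.trivalent v hv)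
      (TropicalPolynomial.continuous_lineCoord a b) hev
      ((f.lineCoord_injOn hab).mono fun x hx => hx.2 (hr.1 hx.1))
  · obtain ⟨a, ha, rfl⟩ := hF.exists_eq_region hclosed hne hr
    exact PlaneEmbedding.not_onBothSides hr.1 f.dense_compl_curve (f.convex_region a)
      (f.isOpen_region a) (f.disjoint_region_curve ha) hF.nonempty e he
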